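/- Let $n\ge 2$, let $V$ be an $n$-dimensional vector space over a field $\mathbb F$ with a fixed basis $\hat e_1,\dots,\hat e_n$, and let $N=\{1,\dots,n\}$. **Trace diagrams.** An $n$-trace diagram $\mathcal D$ consists of finite disjoint vertex sets $V_1,V_2,V_n$, a finite set $E$ of edges (multiple edges, loops, and trivial loops meeting no vertex are allowed), where the vertices in $V_i$ have degree $i$ (loops count twice), an ordering $\sigma_v(1),\sigma_v(2),\dots$ of the edges at each vertex $v$, and a label $\ell(m)$ for each $m\in V_2$. The elements of $V_2$ are the matrix markings; $\sigma_m(1)$ is the incoming and $\sigma_m(2)$ the outgoing edge of $m$. The labels are symbols, and an assignment $A$ gives for each symbol $\ell$ a linear transformation $A_\ell$ of $V$, identified with its $n\times n$ matrix. A framing is a partition of $V_1$ into an ordered collection of $p$ inputs and an ordered collection of $q$ outputs. **Functions.** A coloring $\kappa:E\to N$ is proper if the edges at each $n$-vertex have distinct colors, that is, if $\pi_\kappa(v): i\mapsto\kappa(\sigma_v(i))$ is a permutation for every $v\in V_n$. For $\alpha\in N^p$, $\beta\in N^q$ put $$\chi_{\alpha\cup\beta}(\mathcal D)=\sum_{\kappa}\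 \prod_{v\in V_n}\mathrm{sgn}(\pi_\kappa(v))\ \prod_{m\in V_2}\bigl(A_{\ell(m)}\bigr)_{\kappa(\sigma_m(2)),\,\kappa(\sigma_m(1))},$$ summed over the proper colorings $\kappa$ that give the edges at the inputs and outputs the colors $\alpha$ and $\beta$. The trace diagram function $f_{\mathcal D,A}:V^{\otimes p}\to V^{\otimes q}$ is the linear map with $\hat e_\alpha\mapsto\sum_{\beta\in N^q}\chi_{\alpha\cup\beta}(\mathcal D)\,\hat e_\beta$. **Compatible collections.** A set of markings is a compatible matrix collection if its members have the same label, are all adjacent to one common $n$-vertex, and have the same orientation relative to it (all are joined to it by their incoming edge, or all by their outgoing edge). If every marking is adjacent to an $n$-vertex, the compatible partition number $N_{\mathcal D}$ is the minimum number of collections in a partition of the set of all markings into compatible collections. **Theorem.** Let $\mathcal D$ be a framed $n$-trace diagram in which every matrix marking is adjacent to an $n$-vertex. Then $f_{\mathcal D}$ may be expressed as a sum of products of $N_{\mathcal D}$ matrix minors, with constants that do not depend on the matrix entries. Precisely, there are a partition of the markings into $N_{\mathcal D}$ compatible collections $C_1,\dots,C_{N_{\mathcal D}}$ with labels $\ell_1,\dots,\ell_{N_{\mathcal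 D}}$, an integer $T\ge 0$, increasing sequences $I_{t,j},J_{t,j}$ in $N$ of length $|C_j|$, and integers $c_{t,\alpha,\beta}$ (for $1\le t\le T$, $1\le j\le N_{\mathcal D}$, $\alpha\in N^p$, $\beta\in N^q$) such that for every assignment $A$ of linear transformations to the labels and every $\alpha\in N^p$, $$f_{\mathcal D,A}(\hat e_\alpha)=\sum_{\beta\in N^q}\Bigl(\sum_{t=1}^{T}c_{t,\alpha,\beta}\prod_{j=1}^{N_{\mathcal D}}\bigl[(A_{\ell_j})_{I_{t,j},J_{t,j}}\bigr]\Bigr)\hat e_\beta ,$$ where $[M_{I,J}]$ is the determinant of the submatrix of $M$ with rows $I$ and columns $J$. -/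

import Mathlib

open scoped BigOperators TensorProduct

/-- An `n`-trace diagram with leaves `V₁`, matrix markings (degree-2 vertices) `V₂`,
`n`-vertices `Vₙ` and edges `E`.  The fields `leafEdge`, `markEdge`, `nodeEdge` are the
ciliation: the ordered lists of edges at the vertices, of lengths `1`, `2` and `n`.  Counted with
multiplicity, an edge occurs twice in these lists (once at each of its two ends, or twice at the
same vertex if it is a loop), or not at all (a trivial loop that meets no vertex).

`label` gives the matrix label, a symbol in `L`, of a marking; the linear transformations that
the symbols stand for are supplied separately, by a map `A : L → (V →ₗ[F] V)`. -/
structure TraceDiagram (n : ℕ) (L V₁ V₂ Vₙ E : Type*)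
    [Fintype V₁] [Fintype V₂] [Fintype Vₙ] [DecidableEq E] where
  /-- the edge at a leaf -/
  leafEdge : V₁ → E
  /-- the incoming (`0`) and the outgoing (`1`) edge at a matrix marking -/
  markEdge : V₂ → Fin 2 → E
  /-- the ordered edges at an `n`-vertex -/
  nodeEdge : Vₙ → Fin n → E
  /-- every edge has two ends, or is a trivial loop without ends -/
  ends : ∀ e : E,
    (Finset.univ.filter fun x : V₁ => leafEdge x = e).card
      + (Finset.univ.filter fun x : V₂ × Fin 2 => markEdge x.1 x.2 = e).card
      + (Finset.univ.filter fun x : Vₙ × Fin n => nodeEdge x.1 x.2 = e).card ∈ ({0, 2} : Set ℕ)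
  /-- the matrix label of a marking -/
  label : V₂ → L

/-- A framing: the leaves are partitioned into an ordered collection of `p` inputs and an ordered
collection of `q` outputs. -/
abbrev Framing (V₁ : Type*) (p q : ℕ) := Fin p ⊕ Fin q ≃ V₁

namespace TraceDiagram

/-- The signature of `i ↦ f i` if it is a permutation (and `0` otherwise). -/
noncomputable def mapSign {n : ℕ} (f : Fin n → Fin n) : ℤ :=
  open Classical in
  if h : Function.Bijective f then (Equiv.Perm.sign (Equiv.ofBijective f h) : ℤ) else 0

/-- The minor `[M_{I,J}]`: the determinant of the submatrix with rows `I₁ < ⋯ < I_k` and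
columns `J₁ < ⋯ < J_k`. -/
def minor {n k : ℕ} {R : Type*} [CommRing R] (M : Matrix (Fin n) (Fin n) R)
    (I J : Fin k ↪o Fin n) : R :=
  (M.submatrix I J).det

variable {n : ℕ} {L V₁ V₂ Vₙ E : Type*} [Fintype V₁] [Fintype V₂] [Fintype Vₙ] [DecidableEq E]

/-- A coloring of the edges is proper if the labels at each `n`-vertex are distinct. -/
def IsProper (D : TraceDiagram n L V₁ V₂ Vₙ E) (κ : E → Fin n) : Prop :=
  ∀ v : Vₙ, Function.Injective fun i => κ (D.nodeEdge v i)

/-- The signature of a coloring: the product of the signatures of the permutations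
`i ↦ κ (σ_v i)` over all `n`-vertices `v`. -/
noncomputable def colorSign (D : TraceDiagram n L V₁ V₂ Vₙ E) (κ : E → Fin n) : ℤ :=
  ∏ v : Vₙ, mapSign fun i => κ (D.nodeEdge v i)

section Function

variable {F V : Type*} [Field F] [AddCommGroup V] [Module F V]

/-- The coefficient `ψ_κ` of a coloring: the product over all markings of the matrix entries in
the row of the outgoing and the column of the incoming label. -/
noncomputable def coefficient (D : TraceDiagram n L V₁ V₂ Vₙ E) (b : Module.Basis (Fin n) F V)
    (A : L → (V →ₗ[F] V)) (κ : E → Fin n) : F :=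
  ∏ m : V₂, LinearMap.toMatrix b b (A (D.label m)) (κ (D.markEdge m 1)) (κ (D.markEdge m 0))

/-- The weight `χ_γ` of a labeling `γ` of the leaves: the sum over the proper colorings that give
the edge at each leaf `x` the label `γ x`. There is no such coloring if `γ` gives different labels
to the two ends of an edge that joins two leaves. -/
noncomputable def weight [Fintype E] (D : TraceDiagram n L V₁ V₂ Vₙ E)
    (b : Module.Basis (Fin n) F V) (A : L → (V →ₗ[F] V)) (γ : V₁ → Fin n) : F :=
  open Classical in
  ∑ κ ∈ Finset.univ.filter fun κ : E → Fin n => D.IsProper κ ∧ ∀ x, κ (D.leafEdge x) = γ x,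
    (D.colorSign κ : F) * D.coefficient b A κ

/-- The leaf labeling `α ∪ β` given by labels of the inputs and of the outputs. -/
def leafLabels {p q : ℕ} (fr : Framing V₁ p q) (α : Fin p → Fin n) (β : Fin q → Fin n) :
    V₁ → Fin n :=
  fun x => Sum.elim α β (fr.symm x)

/-- The basis tensor `e_α = e_{α₁} ⊗ ⋯ ⊗ e_{α_k}`. -/
noncomputable def basisTensor (b : Module.Basis (Fin n) F V) {k : ℕ} (α : Fin k → Fin n) :
    ⨂[F] _ : Fin k, V :=
  PiTensorProduct.tprod F fun i => b (α i)

/-- The trace diagram function `V^{⊗p} → V^{⊗q}`, the linear extension of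
`e_α ↦ ∑_β χ_{α ∪ β} e_β`. -/
noncomputable def function [Fintype E] (D : TraceDiagram n L V₁ V₂ Vₙ E) {p q : ℕ}
    (fr : Framing V₁ p q) (b : Module.Basis (Fin n) F V) (A : L → (V →ₗ[F] V)) :
    (⨂[F] _ : Fin p, V) →ₗ[F] (⨂[F] _ : Fin q, V) :=
  (Basis.piTensorProduct fun _ : Fin p => b).constr F fun α =>
    ∑ β : Fin q → Fin n, D.weight b A (leafLabels fr α β) • basisTensor b β

end Function

/-- The marking `m` is adjacent to the `n`-vertex `v` through its incoming edge (`o = 0`, the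
marking is directed away from `v`) or through its outgoing edge (`o = 1`, towards `v`). -/
def AdjacentVia (D : TraceDiagram n L V₁ V₂ Vₙ E) (m : V₂) (v : Vₙ) (o : Fin 2) : Prop :=
  ∃ i : Fin n, D.nodeEdge v i = D.markEdge m o

/-- A compatible matrix collection: the markings have the same label, are adjacent to the same
`n`-vertex, and have the same orientation relative to it. -/
def IsCompatible (D : TraceDiagram n L V₁ V₂ Vₙ E) (C : Finset V₂) : Prop :=
  ∃ (l : L) (v : Vₙ) (o : Fin 2), ∀ m ∈ C, D.label m = l ∧ D.AdjacentVia m v o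

/-- The compatible partition number: the least number of collections in a partition of all
markings into compatible collections. -/
noncomputable def compatiblePartitionNumber [DecidableEq V₂]
    (D : TraceDiagram n L V₁ V₂ Vₙ E) : ℕ :=
  sInf {r | ∃ P : Finpartition (Finset.univ : Finset V₂),
    (∀ C ∈ P.parts, D.IsCompatible C) ∧ P.parts.card = r}

end TraceDiagram

/-!
Fix a partition of the markings into the least possible number of compatible collections. Each
marking `m` of a collection is joined by one of its edges, here called its inner edge, to the
`n`-vertex `v` of the collection. This edge has one end at `m` and one at `v`, hence no others
(`TraceDiagram.ends_unique`): inner edges of distinct markings are distinct, and no inner edge ends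
at a leaf or at a second marking.

The product of the symmetric groups of the collections therefore acts on colorings by permuting the
colors of the inner edges within each collection. The action leaves the leaf colors alone. It
multiplies the signature by the product of the signs
(`TraceDiagram.Blocks.colorSign_comp_edgePerm`), and in the coefficient of a collection it permutes
either all row indices or all column indices. Since a proper coloring has distinct colors on the
inner edges of a collection, every orbit of proper colorings is free and contains exactly one
coloring that increases along each collection (`TraceDiagram.Blocks.sum_eq_sum_sorted`). By the
Leibniz formula the sum over an orbit is, up to the signature, the product over the collections of
the determinants `det (A (κ (out a)) (κ (in b)))`, with `a` and `b` in the collection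
(`TraceDiagram.Blocks.sum_sign_mul_coefficient`).

Such a determinant is alternating in its sequence of rows and in its sequence of columns, so it is
`0` or, up to sign, a minor with increasing rows and columns. Written as a sum over all
pairs of increasing sequences (`TraceDiagram.det_submatrix_eq_sum_minor`), it has coefficients that
depend on the coloring only; multiplying out gives the required expression for each weight of the
diagram (`TraceDiagram.Blocks.weight_eq_sum_prod_minor`).
-/

open Equiv Function

namespace TraceDiagram

/-! ### Alternating functions of sequences and minors -/

section Sequences

variable {n k : ℕ}

theorem mapSign_of_not_injective {f : Fin n → Fin n} (hf : ¬ Injective f) : mapSign f = 0 := by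
  classical
  rw [mapSign, dif_neg fun h => hf h.1]

theorem mapSign_comp_perm (f : Fin n → Fin n) (σ : Perm (Fin n)) :
    mapSign (f ∘ σ) = Perm.sign σ * mapSign f := by
  classical
  unfold mapSign
  by_cases hf : Bijective f
  · have hfσ : Bijective (f ∘ σ) := hf.comp σ.bijective
    have : Equiv.ofBijective _ hfσ = Equiv.ofBijective f hf * σ := by ext; rfl
    rw [dif_pos hf, dif_pos hfσ, this, Perm.sign_mul, mul_comm]
    push_cast
    rfl
  · rw [dif_neg hf, dif_neg, mul_zero]
    intro h
    apply hf
    convert h.comp σ.symm.bijective using 1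
    ext; simp

theorem existsUnique_perm_strictMono {x : Fin k → Fin n} (hx : Injective x) :
    ∃! σ : Perm (Fin k), StrictMono (x ∘ σ) := by
  refine ⟨Tuple.sort x, (Tuple.monotone_sort x).strictMono_of_injective
    (hx.comp (Tuple.sort x).injective), fun σ hσ => ?_⟩
  have h : x ∘ σ = x ∘ Tuple.sort x := by
    refine (StrictMono.range_inj hσ ((Tuple.monotone_sort x).strictMono_of_injective
      (hx.comp (Tuple.sort x).injective))).1 ?_
    rw [σ.surjective.range_comp, (Tuple.sort x).surjective.range_comp]
  ext i
  rw [hx (congrFun h i)]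

/-- The sign of the permutation `σ` with `x = I ∘ σ`, and `0` if the sequence `x` is not a
rearrangement of the increasing sequence `I`. -/
noncomputable def relSign (x : Fin k → Fin n) (I : Fin k ↪o Fin n) : ℤ :=
  ∑ σ : Perm (Fin k), if x = I ∘ σ then (Perm.sign σ : ℤ) else 0

theorem relSign_of_not_injective {x : Fin k → Fin n} (hx : ¬ Injective x) (I : Fin k ↪o Fin n) :
    relSign x I = 0 := by
  refine Finset.sum_eq_zero fun σ _ => if_neg ?_
  rintro rfl
  exact hx (I.injective.comp σ.injective)

theorem relSign_comp (I I' : Fin k ↪o Fin n) (σ : Perm (Fin k)) [Decidable (I' = I)] :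
    relSign (I ∘ σ) I' = if I' = I then (Perm.sign σ : ℤ) else 0 := by
  have key : ∀ σ' : Perm (Fin k), I ∘ σ = I' ∘ σ' ↔ I' = I ∧ σ' = σ := by
    refine fun σ' => ⟨fun h => ?_, by rintro ⟨rfl, rfl⟩; rfl⟩
    have hI : (I' : Fin k → Fin n) = I := by
      refine (StrictMono.range_inj I'.strictMono I.strictMono).1 ?_
      rw [← σ'.surjective.range_comp I', ← h, σ.surjective.range_comp]
    obtain rfl : I' = I := DFunLike.coe_injective hI
    exact ⟨rfl, Equiv.ext fun i => (I'.injective (congrFun h i)).symm⟩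
  simp only [relSign, key]
  split_ifs with hI <;> simp [hI]

/-- An alternating function of sequences is determined by its values on increasing sequences. -/
theorem eq_sum_relSign {R : Type*} [CommRing R] [Fintype (Fin k ↪o Fin n)]
    (g : (Fin k → Fin n) → R)
    (h_zero : ∀ x, ¬ Injective x → g x = 0)
    (h_perm : ∀ x (σ : Perm (Fin k)), g (x ∘ σ) = ((Perm.sign σ : ℤ) : R) * g x)
    (x : Fin k → Fin n) :
    g x = ∑ I : Fin k ↪o Fin n, (relSign x I : R) * g I := by
  classical
  by_cases hx : Injective x
  · obtain ⟨σ, hσ, -⟩ := existsUnique_perm_strictMono hx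
    let I : Fin k ↪o Fin n := OrderEmbedding.ofStrictMono (x ∘ σ) hσ
    have hxI : x = I ∘ σ.symm := by ext i; simp [I]
    rw [hxI, Finset.sum_eq_single I]
    · rw [h_perm, relSign_comp, if_pos rfl]
    · intro I' _ hI'
      rw [relSign_comp, if_neg hI', Int.cast_zero, zero_mul]
    · simp
  · rw [h_zero x hx, Finset.sum_eq_zero]
    intro I _
    rw [relSign_of_not_injective hx, Int.cast_zero, zero_mul]

/-- The determinant of a matrix of entries with arbitrary row and column sequences is an integer
combination of minors, with coefficients independent of the matrix. -/
theorem det_submatrix_eq_sum_minor {R : Type*} [CommRing R] [Fintype (Fin k ↪o Fin n)]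
    (M : Matrix (Fin n) (Fin n) R) (x y : Fin k → Fin n) :
    (M.submatrix x y).det = ∑ IJ : (Fin k ↪o Fin n) × (Fin k ↪o Fin n),
      ((relSign x IJ.1 * relSign y IJ.2 : ℤ) : R) * minor M IJ.1 IJ.2 := by
  have hrow := eq_sum_relSign (fun x => (M.submatrix x y).det)
    (fun x hx => by
      obtain ⟨i, j, hij, hne⟩ : ∃ i j, x i = x j ∧ i ≠ j := by
        simpa [Injective] using hx
      exact Matrix.det_zero_of_row_eq hne (by ext; simp [hij]))
    (fun x σ => by
      rw [← Matrix.det_permute]; rfl) x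
  have hcol := fun I : Fin k ↪o Fin n => eq_sum_relSign (fun y => (M.submatrix I y).det)
    (fun y hy => by
      obtain ⟨i, j, hij, hne⟩ : ∃ i j, y i = y j ∧ i ≠ j := by
        simpa [Injective] using hy
      exact Matrix.det_zero_of_column_eq hne (by simp [hij]))
    (fun y σ => by
      rw [← Matrix.det_permute']; rfl) y
  rw [hrow, Fintype.sum_prod_type]
  refine Finset.sum_congr rfl fun I _ => ?_
  rw [hcol, Finset.mul_sum]
  refine Finset.sum_congr rfl fun J _ => ?_
  rw [minor]
  push_cast
  ring

end Sequences

/-! ### The sign of a permutation that acts fiberwise -/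

theorem sign_sigmaCongrRight {ι : Type*} [Fintype ι] [DecidableEq ι] {β : ι → Type*}
    [∀ j, Fintype (β j)] [∀ j, DecidableEq (β j)] (τ : ∀ j, Perm (β j)) :
    Perm.sign (Perm.sigmaCongrRight τ) = ∏ j, Perm.sign (τ j) := by
  -- embed `Σ j, β j` in `ι × Σ j, β j` and extend each `τ j` by the identity
  let g : (Σ j, β j) ↪ ι × Σ j, β j := ⟨fun s => (s.1, s), fun _ _ h => congrArg Prod.snd h⟩
  let ρ : ι → Perm (Σ j, β j) := fun j => (τ j).viaFintypeEmbedding (Embedding.sigmaMk j)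
  have h : (Perm.sigmaCongrRight τ).viaFintypeEmbedding g = Equiv.prodCongrRight ρ := by
    refine Equiv.ext fun x => ?_
    obtain ⟨i, j, a⟩ := x
    rw [Equiv.prodCongrRight_apply]
    by_cases hij : i = j
    · subst hij
      rw [show (i, (⟨i, a⟩ : Σ j, β j)) = g ⟨i, a⟩ from rfl, Perm.viaFintypeEmbedding_apply_image,
        show (⟨i, a⟩ : Σ j, β j) = Embedding.sigmaMk i a from rfl,
        Perm.viaFintypeEmbedding_apply_image]
      rfl
    · rw [Perm.viaFintypeEmbedding_apply_notMem_range, Perm.viaFintypeEmbedding_apply_notMem_range]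
      · rintro ⟨b, hb⟩
        exact hij (congrArg Sigma.fst hb)
      · rintro ⟨s, hs⟩
        have h1 := congrArg Prod.fst hs
        have h2 := congrArg Prod.snd hs
        simp only [g] at h1 h2
        subst h2
        exact hij h1.symm
  rw [← Perm.viaFintypeEmbedding_sign _ g, h, Perm.sign_prodCongrRight]
  exact Finset.prod_congr rfl fun j _ => Perm.viaFintypeEmbedding_sign _ _

/-! ### Edges between markings and `n`-vertices -/

variable {n : ℕ} {L V₁ V₂ Vₙ E : Type*} [Fintype V₁] [Fintype V₂] [Fintype Vₙ] [DecidableEq E]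

/-- An edge from a marking to an `n`-vertex has no further ends. -/
theorem ends_unique (D : TraceDiagram n L V₁ V₂ Vₙ E) {m : V₂} {o : Fin 2} {v : Vₙ} {i : Fin n}
    (h : D.nodeEdge v i = D.markEdge m o) :
    (∀ x, D.leafEdge x ≠ D.markEdge m o) ∧
    (∀ m' o', D.markEdge m' o' = D.markEdge m o → m' = m ∧ o' = o) ∧
    ∀ v' i', D.nodeEdge v' i' = D.markEdge m o → v' = v ∧ i' = i := by
  classical
  have hends := D.ends (D.markEdge m o)
  set S₁ := Finset.univ.filter fun x : V₁ => D.leafEdge x = D.markEdge m o with hS₁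
  set S₂ := Finset.univ.filter fun x : V₂ × Fin 2 => D.markEdge x.1 x.2 = D.markEdge m o with hS₂
  set S₃ := Finset.univ.filter fun x : Vₙ × Fin n => D.nodeEdge x.1 x.2 = D.markEdge m o with hS₃
  have h₂ : (m, o) ∈ S₂ := by simp [hS₂]
  have h₃ : (v, i) ∈ S₃ := by simp [hS₃, h]
  have c₂ := Finset.card_pos.2 ⟨_, h₂⟩
  have c₃ := Finset.card_pos.2 ⟨_, h₃⟩
  simp only [Set.mem_insert_iff, Set.mem_singleton_iff] at hends
  refine ⟨fun x hx => ?_, fun m' o' h' => ?_, fun v' i' h' => ?_⟩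
  · have : 0 < S₁.card := Finset.card_pos.2 ⟨x, by simp [hS₁, hx]⟩
    omega
  · have := Finset.card_le_one.1 (show S₂.card ≤ 1 by omega) (m', o') (by simp [hS₂, h']) _ h₂
    simpa using this
  · have := Finset.card_le_one.1 (show S₃.card ≤ 1 by omega) (v', i') (by simp [hS₃, h']) _ h₃
    simpa using this

/-- A partition of the markings into compatible collections, indexed by `ι` and enumerated: the
markings `mark ⟨j, a⟩`, `a < k j`, form the `j`-th collection, and the edges at their ends of
orientation `side j` are attached to the `n`-vertex `vtx j`. -/
structure Blocks (D : TraceDiagram n L V₁ V₂ Vₙ E) (ι : Type*) (k : ι → ℕ) where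
  /-- the enumeration of the markings -/
  mark : (Σ j, Fin (k j)) ≃ V₂
  /-- the common label of a collection -/
  lab : ι → L
  /-- the common `n`-vertex of a collection -/
  vtx : ι → Vₙ
  /-- the orientation of a collection relative to its `n`-vertex -/
  side : ι → Fin 2
  /-- the position of the inner edge of a marking among the edges at the `n`-vertex -/
  pos : (Σ j, Fin (k j)) → Fin n
  label_mark : ∀ s, D.label (mark s) = lab s.1
  nodeEdge_pos : ∀ s, D.nodeEdge (vtx s.1) (pos s) = D.markEdge (mark s) (side s.1)

namespace Blocks

variable {D : TraceDiagram n L V₁ V₂ Vₙ E} {ι : Type*} {k : ι → ℕ} (B : Blocks D ι k)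

theorem inner_injective : Injective fun s => D.markEdge (B.mark s) (B.side s.1) := fun _ t h =>
  B.mark.injective ((D.ends_unique (B.nodeEdge_pos t)).2.1 _ _ h).1

/-- The inner edges: those that join a marking to the `n`-vertex of its collection. -/
def inner : (Σ j, Fin (k j)) ↪ E :=
  ⟨fun s => D.markEdge (B.mark s) (B.side s.1), B.inner_injective⟩

theorem inner_apply (s) : B.inner s = D.markEdge (B.mark s) (B.side s.1) := rfl

/-- The ends of the inner edges at the `n`-vertices. -/
def innerEnd : (Σ j, Fin (k j)) ↪ Vₙ × Fin n where
  toFun s := (B.vtx s.1, B.pos s)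
  inj' _ _ h := by
    apply B.inner_injective
    simp only [Prod.mk.injEq] at h
    simp only [← B.nodeEdge_pos, h.1, h.2]

theorem innerEnd_apply (s) : B.innerEnd s = (B.vtx s.1, B.pos s) := rfl

/-- A coloring is sorted if the colors of the inner edges of each collection increase. -/
def Sorted (κ : E → Fin n) : Prop :=
  ∀ j, StrictMono fun a => κ (B.inner ⟨j, a⟩)

theorem injective_of_colorSign_ne_zero {κ : E → Fin n} (h : D.colorSign κ ≠ 0) (j : ι) :
    Injective fun a => κ (B.inner ⟨j, a⟩) := by
  by_contra hj
  refine h (Finset.prod_eq_zero (Finset.mem_univ (B.vtx j)) (mapSign_of_not_injective fun hi => ?_))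
  refine hj fun a a' haa => ?_
  have h₁ : B.pos ⟨j, a⟩ = B.pos ⟨j, a'⟩ := hi (by
    simp only [B.nodeEdge_pos ⟨j, a⟩, B.nodeEdge_pos ⟨j, a'⟩]; exact haa)
  have := B.innerEnd.injective (Prod.ext rfl h₁ : B.innerEnd ⟨j, a⟩ = B.innerEnd ⟨j, a'⟩)
  simpa using this

/-! ### Permuting the inner edges of each collection -/

variable [Fintype ι]

/-- The permutation of the edges that permutes the inner edges of each collection `j` by `τ j`. -/
def edgePerm (τ : ∀ j, Perm (Fin (k j))) : Perm E :=
  (Perm.sigmaCongrRight τ).viaFintypeEmbedding B.inner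

theorem edgePerm_inner (τ : ∀ j, Perm (Fin (k j))) (j : ι) (a : Fin (k j)) :
    B.edgePerm τ (D.markEdge (B.mark ⟨j, a⟩) (B.side j)) =
      D.markEdge (B.mark ⟨j, τ j a⟩) (B.side j) :=
  Perm.viaFintypeEmbedding_apply_image (Perm.sigmaCongrRight τ) B.inner ⟨j, a⟩

theorem edgePerm_leafEdge (τ : ∀ j, Perm (Fin (k j))) (x : V₁) :
    B.edgePerm τ (D.leafEdge x) = D.leafEdge x := by
  apply Perm.viaFintypeEmbedding_apply_notMem_range
  rintro ⟨s, hs⟩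
  exact (D.ends_unique (B.nodeEdge_pos s)).1 x hs.symm

theorem edgePerm_outer (τ : ∀ j, Perm (Fin (k j))) (j : ι) (a : Fin (k j)) {o : Fin 2}
    (ho : o ≠ B.side j) :
    B.edgePerm τ (D.markEdge (B.mark ⟨j, a⟩) o) = D.markEdge (B.mark ⟨j, a⟩) o := by
  apply Perm.viaFintypeEmbedding_apply_notMem_range
  rintro ⟨s, hs⟩
  obtain ⟨h₁, h₂⟩ := (D.ends_unique (B.nodeEdge_pos s)).2.1 _ _ hs.symm
  obtain rfl := B.mark.injective h₁
  exact ho h₂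

/-- Permuting the inner edges within the collections multiplies the signature of a coloring by the
signs of the permutations, since it permutes the edges at each `n`-vertex. -/
theorem colorSign_comp_edgePerm [DecidableEq ι] (τ : ∀ j, Perm (Fin (k j))) (κ : E → Fin n) :
    D.colorSign (κ ∘ B.edgePerm τ) = (∏ j, (Perm.sign (τ j) : ℤ)) * D.colorSign κ := by
  classical
  -- the permutation `ρ` of all ends at `n`-vertices that is induced by `τ`; it fixes the vertices,
  -- so its sign, which is that of `τ`, is the product of its signs at the single vertices
  let ρ : Perm (Vₙ × Fin n) := (Perm.sigmaCongrRight τ).viaFintypeEmbedding B.innerEnd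
  have hρ_edge : ∀ x, D.nodeEdge (ρ x).1 (ρ x).2 = B.edgePerm τ (D.nodeEdge x.1 x.2) := by
    intro x
    by_cases hx : x ∈ Set.range B.innerEnd
    · obtain ⟨⟨j, a⟩, rfl⟩ := hx
      have h : ρ (B.innerEnd ⟨j, a⟩) = B.innerEnd ⟨j, τ j a⟩ :=
        Perm.viaFintypeEmbedding_apply_image _ _ _
      rw [h, innerEnd_apply, innerEnd_apply, B.nodeEdge_pos ⟨j, a⟩, B.edgePerm_inner,
        B.nodeEdge_pos ⟨j, τ j a⟩]
    · rw [show ρ x = x from Perm.viaFintypeEmbedding_apply_notMem_range _ _ hx]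
      refine (Perm.viaFintypeEmbedding_apply_notMem_range _ _ ?_).symm
      rintro ⟨s, hs⟩
      obtain ⟨h₁, h₂⟩ := (D.ends_unique (B.nodeEdge_pos s)).2.2 _ _ hs.symm
      exact hx ⟨s, Prod.ext h₁.symm h₂.symm⟩
  have hρ_fst : ∀ x, (ρ x).1 = x.1 := by
    intro x
    by_cases hx : x ∈ Set.range B.innerEnd
    · obtain ⟨⟨j, a⟩, rfl⟩ := hx
      rw [show ρ (B.innerEnd ⟨j, a⟩) = B.innerEnd ⟨j, τ j a⟩ from
        Perm.viaFintypeEmbedding_apply_image _ _ _]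
      rfl
    · rw [show ρ x = x from Perm.viaFintypeEmbedding_apply_notMem_range _ _ hx]
  have hρ_inj : ∀ v, Injective fun i => (ρ (v, i)).2 := fun v i i' h => by
    have := ρ.injective (Prod.ext ((hρ_fst (v, i)).trans (hρ_fst (v, i')).symm) h)
    exact congrArg Prod.snd this
  let ρv : Vₙ → Perm (Fin n) := fun v =>
    Equiv.ofBijective _ (Finite.injective_iff_bijective.1 (hρ_inj v))
  have hρ : ρ = Equiv.prodCongrRight ρv := Equiv.ext fun x => Prod.ext (hρ_fst x) rfl
  have hsign : ∏ v, Perm.sign (ρv v) = ∏ j, Perm.sign (τ j) := by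
    rw [← Perm.sign_prodCongrRight, ← hρ, Perm.viaFintypeEmbedding_sign, sign_sigmaCongrRight]
  have hnode : ∀ v, (fun i => (κ ∘ B.edgePerm τ) (D.nodeEdge v i)) =
      (fun i => κ (D.nodeEdge v i)) ∘ ρv v := by
    intro v
    ext i
    have := hρ_edge (v, i)
    rw [hρ_fst] at this
    simp only [comp_apply, ← this]
    rfl
  have hsign' := congrArg (fun u : ℤˣ => (u : ℤ)) hsign
  simp only [Units.coe_prod] at hsign'
  simp only [colorSign, hnode, mapSign_comp_perm, Finset.prod_mul_distrib, hsign']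

/-- A sum over colorings that only involves proper ones can be taken over the sorted colorings and
their rearrangements, as each proper coloring is sorted by exactly one rearrangement. -/
theorem sum_eq_sum_sorted [Fintype E] [DecidableEq ι] {R : Type*} [CommRing R] [DecidablePred B.Sorted]
    (w : (E → Fin n) → R) (hw : ∀ κ, D.colorSign κ = 0 → w κ = 0) :
    ∑ κ, w κ = ∑ κ, if B.Sorted κ then ∑ τ : ∀ j, Perm (Fin (k j)), w (κ ∘ B.edgePerm τ) else 0 := by
  classical
  have hinv : ∀ τ : ∀ j, Perm (Fin (k j)), B.edgePerm τ⁻¹ = (B.edgePerm τ)⁻¹ := by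
    intro τ
    rw [eq_inv_iff_mul_eq_one]
    refine Equiv.ext fun e => ?_
    by_cases he : e ∈ Set.range B.inner
    · obtain ⟨⟨j, a⟩, rfl⟩ := he
      rw [Perm.mul_apply, inner_apply, edgePerm_inner, edgePerm_inner]
      simp
    · rw [Perm.mul_apply, show B.edgePerm τ e = e from
        Perm.viaFintypeEmbedding_apply_notMem_range _ _ he]
      exact Perm.viaFintypeEmbedding_apply_notMem_range _ _ he
  -- insert the number `1` of rearrangements that sort `κ`; without one, `w κ` vanishes
  have hone : ∀ κ, w κ = ∑ τ : ∀ j, Perm (Fin (k j)),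
      if B.Sorted (κ ∘ B.edgePerm τ) then w κ else 0 := by
    intro κ
    by_cases h : D.colorSign κ = 0
    · simp [hw κ h]
    choose τ hτ hτu using fun j =>
      existsUnique_perm_strictMono (B.injective_of_colorSign_ne_zero h j)
    have hsorted : ∀ τ' : ∀ j, Perm (Fin (k j)), B.Sorted (κ ∘ B.edgePerm τ') ↔ τ' = τ := by
      have : ∀ (τ' : ∀ j, Perm (Fin (k j))) j, (fun a => (κ ∘ B.edgePerm τ') (B.inner ⟨j, a⟩)) =
          (fun a => κ (B.inner ⟨j, a⟩)) ∘ τ' j := by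
        intro τ' j
        ext a
        simp only [comp_apply, inner_apply, edgePerm_inner]
      refine fun τ' => ⟨fun h' => funext fun j => hτu j _ ?_, ?_⟩
      · simpa only [this] using h' j
      · rintro rfl j
        simpa only [this] using hτ j
    simp [hsorted]
  rw [Finset.sum_congr rfl fun κ _ => hone κ, Finset.sum_comm]
  -- for each `τ`, sum over the sorted coloring `κ ∘ B.edgePerm τ` instead of `κ`
  have hswap : ∀ τ : ∀ j, Perm (Fin (k j)),
      (∑ κ, if B.Sorted (κ ∘ B.edgePerm τ) then w κ else 0) =
        ∑ κ, if B.Sorted κ then w (κ ∘ B.edgePerm τ⁻¹) else 0 := by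
    intro τ
    refine Fintype.sum_equiv ((B.edgePerm τ).symm.arrowCongr (Equiv.refl _)) _ _ fun κ => ?_
    have h₁ : ((B.edgePerm τ).symm.arrowCongr (Equiv.refl _)) κ = κ ∘ B.edgePerm τ := rfl
    have h₂ : (κ ∘ B.edgePerm τ) ∘ B.edgePerm τ⁻¹ = κ := by
      ext e; simp [hinv]
    rw [h₁, h₂]
  simp only [hswap]
  refine (Fintype.sum_equiv (Equiv.inv _) _
    (fun τ => ∑ κ, if B.Sorted κ then w (κ ∘ B.edgePerm τ) else 0) fun τ => rfl).trans ?_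
  rw [Finset.sum_comm]
  refine Finset.sum_congr rfl fun κ _ => ?_
  split_ifs <;> simp

/-! ### Weights as sums of products of minors -/

section Function

variable {F V : Type*} [Field F] [AddCommGroup V] [Module F V]

/-- The signed sum of the coefficients over all rearrangements of a coloring is a product of
determinants, by the Leibniz expansion in each collection. -/
theorem sum_sign_mul_coefficient [DecidableEq ι] (b : Module.Basis (Fin n) F V) (A : L → (V →ₗ[F] V))
    (κ : E → Fin n) :
    ∑ τ : ∀ j, Perm (Fin (k j)), ((∏ j, (Perm.sign (τ j) : ℤ) : ℤ) : F) *
        D.coefficient b A (κ ∘ B.edgePerm τ) =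
      ∏ j, ((LinearMap.toMatrix b b (A (B.lab j))).submatrix
        (fun a => κ (D.markEdge (B.mark ⟨j, a⟩) 1))
        (fun a => κ (D.markEdge (B.mark ⟨j, a⟩) 0))).det := by
  -- the factor of a collection depends on `τ` in the rows or in the columns, according to its side
  let f : ∀ j, Perm (Fin (k j)) → F := fun j σ => ((Perm.sign σ : ℤ) : F) *
    ∏ a, LinearMap.toMatrix b b (A (B.lab j))
      (κ (D.markEdge (B.mark ⟨j, if B.side j = 1 then σ a else a⟩) 1))
      (κ (D.markEdge (B.mark ⟨j, if B.side j = 0 then σ a else a⟩) 0))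
  have hedge : ∀ (τ : ∀ j, Perm (Fin (k j))) j a (o : Fin 2),
      B.edgePerm τ (D.markEdge (B.mark ⟨j, a⟩) o) =
        D.markEdge (B.mark ⟨j, if B.side j = o then τ j a else a⟩) o := by
    intro τ j a o
    split_ifs with h
    · subst h; exact B.edgePerm_inner τ j a
    · exact B.edgePerm_outer τ j a (Ne.symm h)
  have hterm : ∀ τ : ∀ j, Perm (Fin (k j)), ((∏ j, (Perm.sign (τ j) : ℤ) : ℤ) : F) *
        D.coefficient b A (κ ∘ B.edgePerm τ) = ∏ j, f j (τ j) := by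
    intro τ
    simp only [f, Finset.prod_mul_distrib, coefficient]
    rw [← B.mark.prod_comp, Fintype.prod_sigma]
    simp only [B.label_mark, comp_apply, hedge]
    push_cast
    rfl
  rw [Finset.sum_congr rfl fun τ _ => hterm τ, ← Fintype.prod_sum]
  refine Finset.prod_congr rfl fun j _ => ?_
  -- on side `0` the columns are permuted: the Leibniz formula for the transpose
  have h01 : B.side j = 0 ∨ B.side j = 1 := by
    generalize B.side j = o
    fin_cases o <;> simp
  rcases h01 with h | h
  · rw [← Matrix.det_transpose, Matrix.det_apply']
    simp [f, h]
  · rw [Matrix.det_apply']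
    simp [f, h]

/-- A weight is a sum over sorted colorings of products of determinants, one for each
collection. -/
theorem weight_eq_sum_sorted [Fintype E] [DecidableEq ι] (b : Module.Basis (Fin n) F V) (A : L → (V →ₗ[F] V))
    (γ : V₁ → Fin n) [DecidablePred fun κ => B.Sorted κ ∧ ∀ x, κ (D.leafEdge x) = γ x] :
    D.weight b A γ = ∑ κ, if B.Sorted κ ∧ ∀ x, κ (D.leafEdge x) = γ x then
      (D.colorSign κ : F) * ∏ j, ((LinearMap.toMatrix b b (A (B.lab j))).submatrix
        (fun a => κ (D.markEdge (B.mark ⟨j, a⟩) 1))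
        (fun a => κ (D.markEdge (B.mark ⟨j, a⟩) 0))).det else 0 := by
  classical
  let w : (E → Fin n) → F := fun κ => if ∀ x, κ (D.leafEdge x) = γ x then
    (D.colorSign κ : F) * D.coefficient b A κ else 0
  have hw : D.weight b A γ = ∑ κ, w κ := by
    rw [weight, Finset.sum_filter]
    refine Finset.sum_congr rfl fun κ _ => ?_
    by_cases hp : D.IsProper κ
    · simp [hp, w]
    -- improper colorings have signature `0`, so the sum may include them
    · obtain ⟨v, hv⟩ := not_forall.1 hp
      have : D.colorSign κ = 0 :=
        Finset.prod_eq_zero (Finset.mem_univ v) (mapSign_of_not_injective hv)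
      simp [hp, w, this]
  rw [hw, B.sum_eq_sum_sorted w fun κ h => by simp [w, h]]
  refine Finset.sum_congr rfl fun κ _ => ?_
  simp only [w, comp_apply, B.edgePerm_leafEdge, B.colorSign_comp_edgePerm]
  by_cases hs : B.Sorted κ
  swap
  · simp [hs]
  by_cases hl : ∀ x, κ (D.leafEdge x) = γ x
  swap
  · simp [hl]
  · rw [if_pos hs, if_pos ⟨hs, hl⟩, ← B.sum_sign_mul_coefficient, Finset.mul_sum]
    refine Finset.sum_congr rfl fun τ _ => ?_
    rw [if_pos hl]
    push_cast
    ring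

/-- The weights are sums of products of minors, one for each collection, with integer
coefficients that depend on the leaf labeling only. -/
theorem weight_eq_sum_prod_minor [Fintype E] [DecidableEq ι] [∀ j, Fintype (Fin (k j) ↪o Fin n)] :
    ∃ c : (∀ j, (Fin (k j) ↪o Fin n) × (Fin (k j) ↪o Fin n)) → (V₁ → Fin n) → ℤ,
      ∀ (b : Module.Basis (Fin n) F V) (A : L → (V →ₗ[F] V)) (γ : V₁ → Fin n),
        D.weight b A γ = ∑ IJ, (c IJ γ : F) *
          ∏ j, minor (LinearMap.toMatrix b b (A (B.lab j))) (IJ j).1 (IJ j).2 := by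
  classical
  refine ⟨fun IJ γ => ∑ κ, if B.Sorted κ ∧ ∀ x, κ (D.leafEdge x) = γ x then
    D.colorSign κ * ∏ j, (relSign (fun a => κ (D.markEdge (B.mark ⟨j, a⟩) 1)) (IJ j).1 *
      relSign (fun a => κ (D.markEdge (B.mark ⟨j, a⟩) 0)) (IJ j).2) else 0, fun b A γ => ?_⟩
  rw [B.weight_eq_sum_sorted]
  simp only [Int.cast_sum, Finset.sum_mul]
  rw [Finset.sum_comm]
  refine Finset.sum_congr rfl fun κ _ => ?_
  split_ifs
  · simp only [det_submatrix_eq_sum_minor, Fintype.prod_sum, Finset.mul_sum]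
    refine Finset.sum_congr rfl fun IJ _ => ?_
    rw [Finset.prod_mul_distrib]
    push_cast
    ring
  · simp

end Function

end Blocks

theorem function_basisTensor [Fintype E] {F V : Type*} [Field F] [AddCommGroup V] [Module F V]
    (D : TraceDiagram n L V₁ V₂ Vₙ E) {p q : ℕ} (fr : Framing V₁ p q)
    (b : Module.Basis (Fin n) F V) (A : L → (V →ₗ[F] V)) (α : Fin p → Fin n) :
    D.function fr b A (basisTensor b α) =
      ∑ β : Fin q → Fin n, D.weight b A (leafLabels fr α β) • basisTensor b β := by
  rw [function, basisTensor, ← Basis.piTensorProduct_apply (fun _ : Fin p => b) α,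
    Module.Basis.constr_basis]

/-! ### Partitions into compatible collections -/

/-- The minimum that defines the compatible partition number is attained: the partition into
singletons is compatible, so the infimum is not one over the empty set. -/
theorem exists_finpartition_compatible [DecidableEq V₂] (D : TraceDiagram n L V₁ V₂ Vₙ E)
    (hD : ∀ m : V₂, ∃ (v : Vₙ) (o : Fin 2), D.AdjacentVia m v o) :
    ∃ P : Finpartition (Finset.univ : Finset V₂),
      (∀ C ∈ P.parts, D.IsCompatible C) ∧ P.parts.card = D.compatiblePartitionNumber := by
  refine Nat.sInf_mem (s := {r | ∃ P : Finpartition (Finset.univ : Finset V₂),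
    (∀ C ∈ P.parts, D.IsCompatible C) ∧ P.parts.card = r}) ⟨_, ⊥, fun C hC => ?_, rfl⟩
  obtain ⟨m, -, rfl⟩ := Finpartition.mem_bot_iff.1 hC
  obtain ⟨v, o, h⟩ := hD m
  exact ⟨D.label m, v, o, by simpa using h⟩

/-- An enumerated partition into compatible collections gives the data of `Blocks`. -/
theorem exists_blocks [DecidableEq V₂] (D : TraceDiagram n L V₁ V₂ Vₙ E) {ι : Type*}
    (P : Finpartition (Finset.univ : Finset V₂)) (hP : ∀ C ∈ P.parts, D.IsCompatible C)
    (C : ι ≃ P.parts) :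
    ∃ B : Blocks D ι fun j => (C j : Finset V₂).card,
      ∀ j, ∀ m ∈ (C j : Finset V₂), D.label m = B.lab j := by
  choose l v o h using fun j => hP _ (C j).2
  let f : (Σ j, Fin (C j : Finset V₂).card) → V₂ := fun s =>
    ((C s.1 : Finset V₂).equivFin.symm s.2 : V₂)
  have hf : ∀ s, f s ∈ (C s.1 : Finset V₂) := fun s => ((C s.1 : Finset V₂).equivFin.symm s.2).2
  have hbij : Bijective f := by
    constructor
    · rintro ⟨j, a⟩ ⟨j', a'⟩ hs
      have hj : (C j : Finset V₂) = C j' :=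
        P.eq_of_mem_parts (C j).2 (C j').2 (hf ⟨j, a⟩) (hs ▸ hf ⟨j', a'⟩)
      obtain rfl := C.injective (Subtype.ext hj)
      exact congrArg (Sigma.mk j) ((C j : Finset V₂).equivFin.symm.injective (Subtype.ext hs))
    · intro m
      obtain ⟨S, hS, hm⟩ := P.exists_mem (Finset.mem_univ m)
      obtain ⟨j, hj⟩ := C.surjective ⟨S, hS⟩
      have hm' : m ∈ (C j : Finset V₂) := by rw [hj]; exact hm
      exact ⟨⟨j, (C j : Finset V₂).equivFin ⟨m, hm'⟩⟩, by simp [f]⟩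
  choose pos hpos using fun s => (h s.1 (f s) (hf s)).2
  exact ⟨⟨Equiv.ofBijective f hbij, l, v, o, pos, fun s => (h s.1 (f s) (hf s)).1, hpos⟩,
    fun j m hm => (h j m hm).1⟩

end TraceDiagram

theorem mainTheorem4 {n : ℕ} (hn : 2 ≤ n) {F V : Type*} [Field F] [AddCommGroup V] [Module F V]
    (b : Module.Basis (Fin n) F V)
    {L V₁ V₂ Vₙ E : Type*} [Fintype V₁] [Fintype V₂] [DecidableEq V₂] [Fintype Vₙ]
    [Fintype E] [DecidableEq E]
    (D : TraceDiagram n L V₁ V₂ Vₙ E) {p q : ℕ} (fr : Framing V₁ p q)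
    (hD : ∀ m : V₂, ∃ (v : Vₙ) (o : Fin 2), D.AdjacentVia m v o) :
    -- a partition of the markings into `N_D` compatible collections, with their labels
    ∃ (P : Finpartition (Finset.univ : Finset V₂))
      (C : Fin D.compatiblePartitionNumber ≃ P.parts)
      (l : Fin D.compatiblePartitionNumber → L),
      (∀ j, D.IsCompatible (C j : Finset V₂) ∧ ∀ m ∈ (C j : Finset V₂), D.label m = l j) ∧
      -- finitely many products of `N_D` minors, with integer coefficients
      ∃ (T : ℕ)
        (I J : Fin T → (j : Fin D.compatiblePartitionNumber) →
          Fin (C j : Finset V₂).card ↪o Fin n)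
        (c : Fin T → (Fin p → Fin n) → (Fin q → Fin n) → ℤ),
        ∀ (A : L → (V →ₗ[F] V)) (α : Fin p → Fin n),
          D.function fr b A (TraceDiagram.basisTensor b α) =
            ∑ β : Fin q → Fin n,
              (∑ t : Fin T, (c t α β : F) *
                ∏ j : Fin D.compatiblePartitionNumber,
                  TraceDiagram.minor (LinearMap.toMatrix b b (A (l j))) (I t j) (J t j)) •
              TraceDiagram.basisTensor b β := by
  classical
  obtain ⟨P, hP, hcard⟩ := D.exists_finpartition_compatible hD
  let C : Fin D.compatiblePartitionNumber ≃ P.parts := (P.parts.equivFinOfCardEq hcard).symm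
  obtain ⟨B, hB⟩ := D.exists_blocks P hP C
  have : ∀ j, Fintype (Fin (C j : Finset V₂).card ↪o Fin n) := fun j => Fintype.ofFinite _
  obtain ⟨c, hc⟩ := B.weight_eq_sum_prod_minor (F := F) (V := V)
  let e := (Fintype.equivFin (∀ j, (Fin (C j : Finset V₂).card ↪o Fin n) ×
    (Fin (C j : Finset V₂).card ↪o Fin n))).symm
  refine ⟨P, C, B.lab, fun j => ⟨hP _ (C j).2, hB j⟩, _, fun t j => (e t j).1,
    fun t j => (e t j).2, fun t α β => c (e t) (TraceDiagram.leafLabels fr α β), fun A α => ?_⟩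
  rw [D.function_basisTensor]
  refine Finset.sum_congr rfl fun β _ => ?_
  rw [hc, ← e.sum_comp]
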